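/- **Conventions.** An objective over a set of colours $C$ is a set $W\subseteq C^\omega$; it is prefix-independent if $uw\in W\Leftrightarrow w\in W$ for all $u\in C^*$, $w\in C^\omega$. A $C$-graph is a set of vertices with a set of $C$-coloured directed edges $v\xrightarrow{c}v'$ in which every vertex has an outgoing edge. A $C$-game consists of a $C$-graph $G$, a set of vertices controlled by Eve (the others are controlled by Adam), an initial vertex $v_0$ and an objective. A strategy (for Eve) is a $C$-graph $S$ with a colour-preserving graph morphism $\pi:S\to G$ and a vertex $s_0$ with $\pi(s_0)=v_0$, such that whenever $\pi(s)$ is controlled by Adam and $\pi(s)\xrightarrow{c}v'$ in $G$, there is $s'$ with $\pi(s')=v'$ and $s\xrightarrow{c}s'$ in $S$. It is winning if the colours of every infinite path from $s_0$ in $S$ form a word of the objective; Eve wins the game if some strategy is winning. Let $\varepsilon\notin C$. The $\varepsilon$-extension $W^\varepsilon\subseteq(C\sqcup\{\varepsilon\})^\omega$ of $W$ consists of the words $w$ whose projection $w_C$ (obtained by erasing all $\varepsilon$'s) is infinite and in $W$, or is finite and satisfies $w_Cw'\in W$ for some $w'\in C^\omega$. An $\varepsilon$-strategy over a set $M$,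 in a $(C\sqcup\{\varepsilon\})$-game, is a strategy whose vertices form a subset of $V(G)\times M$, with $\pi(v,m)=v$, and in which $(v,m)\xrightarrow{\varepsilon}(v',m')$ implies $m=m'$. The objective $W$ has $\varepsilon$-memory $\le\mu$ if in every $(C\sqcup\{\varepsilon\})$-game with objective $W^\varepsilon$ there is an $\varepsilon$-strategy over some set $M$ with $|M|\le\mu$ that attains the value of the game, that is, which is winning if and only if Eve wins the game. For objectives $W_1$ and $W_2$ over disjoint sets of colours $C_1$ and $C_2$, the lexicographic product $W_1\ltimes W_2$ is the objective over $C_1\sqcup C_2$ consisting of the words $w$ such that either $w^2$ is infinite and $w^2\in W_2$, or $w^2$ is finite and $w^1\in W_1$, where $w^i$ is the restriction of $w$ to the letters from $C_i$. For a colour $a$, the trivially winning and the trivially losing objectives over $\{a\}$ are $\mathrm{TW}(a)=\{a^\omega\}$ and $\mathrm{TL}(a)=\emptyset$. **Statement.** (1) Let $W_1$ and $W_2$ be prefix-independent objectives over disjoint sets of colours $C_1$ and $C_2$, with $\varepsilon$-memory $\le n_1$ and $\le n_2$ respectively, where $n_1,n_2\in\mathbb N$. Then $W_1\ltimes W_2$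 has $\varepsilon$-memory $\le n_1n_2$. (2) Let $W$ be a prefix-independent objective over $C$ with $\varepsilon$-memory $\le m\in\mathbb N$, and let $a\notin C$. Then each of the objectives $W\ltimes\mathrm{TL}(a)$, $W\ltimes\mathrm{TW}(a)$, $\mathrm{TL}(a)\ltimes W$ and $\mathrm{TW}(a)\ltimes W$ over $C\sqcup\{a\}$ has $\varepsilon$-memory $\le m$. -/

import Mathlib

open scoped Cardinal

universe u v w

/-! ### Words and objectives

Infinite words over `C` are maps `ℕ → C`; an objective over `C` is a set of infinite words. -/

/-- The infinite word `l · x`. -/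
def wordAppend {C : Type u} (l : List C) (x : ℕ → C) : ℕ → C :=
  fun i => if h : i < l.length then l[i] else x (i - l.length)

/-- `u x ∈ W ↔ x ∈ W` for all finite words `u` and infinite words `x`. -/
def PrefixIndependent {C : Type u} (W : Set (ℕ → C)) : Prop :=
  ∀ (l : List C) (x : ℕ → C), wordAppend l x ∈ W ↔ x ∈ W

/-- Positions of `x` whose letter is kept by the partial map `f` (a letter `d` is kept, as the
letter `c`, when `f d = some c`, and is erased when `f d = none`). -/
def keptPositions {D : Type u} {C : Type v} (f : D → Option C) (x : ℕ → D) : Set ℕ :=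
  {i | (f (x i)).isSome}

/-- The infinite word obtained from `x` by erasing the letters that are not kept by `f`, when
infinitely many letters are kept. -/
noncomputable def restrictInf {D : Type u} {C : Type v} (f : D → Option C) (x : ℕ → D)
    (h : (keptPositions f x).Infinite) : ℕ → C :=
  fun n => (f (x (Nat.nth (· ∈ keptPositions f x) n))).get (Nat.nth_mem_of_infinite h n)

/-- The finite word obtained by erasing, from the first `N` letters of `x`, those that are not
kept by `f`. -/
def restrictPrefix {D : Type u} {C : Type v} (f : D → Option C) (x : ℕ → D) (N : ℕ) : List C :=
  (List.range N).filterMap fun i => f (x i)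

/-- The `ε`-extension of an objective `W` over `C`, an objective over `C ⊔ {ε} = Option C`, with
`none` in the role of `ε`. A word with infinitely many letters from `C` belongs to it if its
projection to `C` is in `W`; a word whose projection is a finite word `l` belongs to it if
`l · y ∈ W` for some infinite word `y`. In the second case, `l` is read off any prefix of
length `N` after which there are only `ε`'s. -/
def epsExtension {C : Type u} (W : Set (ℕ → C)) : Set (ℕ → Option C) :=
  {x | (∃ h : (keptPositions id x).Infinite, restrictInf id x h ∈ W) ∨
    (∃ N : ℕ, (∀ i, N ≤ i → x i = none) ∧
      ∃ y : ℕ → C, wordAppend (restrictPrefix id x N) y ∈ W)}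

/-- The lexicographic product `W₁ ⋉ W₂` over the disjoint union `C₁ ⊕ C₂`: the words `x` such
that either the restriction of `x` to `C₂` is infinite and in `W₂`, or it is finite and the
restriction of `x` to `C₁` (which is then infinite) is in `W₁`. -/
def lexProduct {C₁ : Type u} {C₂ : Type v} (W₁ : Set (ℕ → C₁)) (W₂ : Set (ℕ → C₂)) :
    Set (ℕ → C₁ ⊕ C₂) :=
  {x | (∃ h : (keptPositions Sum.getRight? x).Infinite, restrictInf Sum.getRight? x h ∈ W₂) ∨
    ((keptPositions Sum.getRight? x).Finite ∧
      ∃ h : (keptPositions Sum.getLeft? x).Infinite, restrictInf Sum.getLeft? x h ∈ W₁)}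

/-- The trivially winning objective `{a^ω}` over a one-letter set of colours. -/
def triviallyWinning : Set (ℕ → PUnit.{u + 1}) := {fun _ => PUnit.unit}

/-- The trivially losing objective `∅` over a one-letter set of colours. -/
def triviallyLosing : Set (ℕ → PUnit.{u + 1}) := ∅

/-! ### Graphs, games and strategies -/

/-- A `C`-graph with vertex set `V`: a set of `C`-coloured directed edges, without sinks. -/
structure ColouredGraph (V : Type u) (C : Type v) where
  Edge : V → C → V → Prop
  exists_edge : ∀ x, ∃ c y, Edge x c y

/-- The vertex `x` satisfies `W`: all infinite paths from `x` are labelled by words of `W`. -/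
def ColouredGraph.Satisfies {V : Type u} {C : Type v} (G : ColouredGraph V C)
    (W : Set (ℕ → C)) (x : V) : Prop :=
  ∀ (p : ℕ → V) (c : ℕ → C), p 0 = x → (∀ i, G.Edge (p i) (c i) (p (i + 1))) → c ∈ W

/-- A game arena: a `C`-graph, the set of vertices controlled by Eve (the other ones are
controlled by Adam), and an initial vertex. Together with an objective, this is a game. -/
structure Arena (V : Type u) (C : Type v) extends ColouredGraph V C where
  eve : Set V
  init : V

/-- A strategy for Eve: a graph with vertex set `S`, a projection to the arena which is a graph
morphism, and an initial vertex above the initial vertex of the arena, such that every move of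
Adam in the arena can be followed in `S`. -/
structure Strategy {V : Type u} {C : Type v} (G : Arena V C) (S : Type w)
    extends ColouredGraph S C where
  proj : S → V
  init : S
  proj_edge : ∀ s c s', Edge s c s' → G.Edge (proj s) c (proj s')
  proj_init : proj init = G.init
  adam : ∀ s c y, proj s ∉ G.eve → G.Edge (proj s) c y → ∃ s', proj s' = y ∧ Edge s c s'

/-- A strategy is winning if all infinite paths from its initial vertex satisfy the objective. -/
def Strategy.IsWinning {V : Type u} {C : Type v} {G : Arena V C} {S : Type w}
    (σ : Strategy G S) (W : Set (ℕ → C)) : Prop :=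
  σ.toColouredGraph.Satisfies W σ.init

/-- Eve wins the game on `G` with objective `W`. -/
def Arena.EveWins {V C : Type u} (G : Arena V C) (W : Set (ℕ → C)) : Prop :=
  ∃ (S : Type u) (σ : Strategy G S), σ.IsWinning W

/-- A strategy over a set `A ⊆ V × M` is an `ε`-strategy over the set `M` of memory states if it
projects `(v, m)` to `v` (it is a product strategy) and does not change the memory state along
`ε`-edges. -/
def Strategy.IsEpsStrategy {V C M : Type u} {G : Arena V (Option C)} {A : Set (V × M)}
    (σ : Strategy G A) : Prop :=
  (∀ s : A, σ.proj s = s.1.1) ∧ ∀ s s' : A, σ.Edge s none s' → s.1.2 = s'.1.2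

/-- `W` has `ε`-memory `≤ μ`: in every game over `C ⊔ {ε}` whose objective is the `ε`-extension
of `W`, the value of the game is attained by an `ε`-strategy over a set of at most `μ` memory
states. For objectives, the value of a game (resp. of a strategy) only says whether Eve wins it
(resp. whether it is winning). -/
def HasEpsMemoryLE {C : Type u} (W : Set (ℕ → C)) (μ : Cardinal.{u}) : Prop :=
  ∀ (V : Type u) (G : Arena V (Option C)),
    ∃ (M : Type u) (A : Set (V × M)) (σ : Strategy G A),
      #M ≤ μ ∧ σ.IsEpsStrategy ∧ (σ.IsWinning (epsExtension W) ↔ G.EveWins (epsExtension W))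

/-! For prefix-independent `W`, having `ε`-memory at most `μ` amounts (for `μ ≥ 1`) to a structural
property, `HasOrderings`: the vertices of any forest satisfying `W` can be split into at most `μ`
fibres and given well-founded ranks so that `ε`-edges stay in their fibre without increasing the
rank, and adding all such `ε`-edges creates no path violating `W`.

From memory to orderings (`HasEpsMemoryLE.hasOrderings`): Adam walks in the forest and may propose a
set of vertices containing the current one, from which Eve picks a vertex. She wins by always
returning. An `ε`-strategy cannot remember, within a memory state, where the proposal was made, so
her choice is reachable by `ε`'s from every proposed vertex of that memory state. This makes
non-reachability well-founded.

From orderings to memory (`HasOrderings.hasEpsMemoryLE`): unfold a winning strategy into a forest,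
and play at each pair (vertex, fibre) as at a representative of least rank. Jumping to the
representative follows an added `ε`-edge.

Orderings multiply (`HasOrderings.lexProduct`): pair the fibres and order lexicographically, the
rank for `W₂` first. Along a path with finitely many `C₂`-letters this first rank stabilises, and a
suffix is then governed by the ordering for `W₁`. Part (2) follows since the trivial objectives have
`ε`-memory at most 1. -/

/-! ### Erasing letters from infinite words -/

/-- Erasing the letters `none` from `x` yields the infinite word `c`. -/
def ProjectsTo {C : Type u} (x : ℕ → Option C) (c : ℕ → C) : Prop :=
  ∃ g : ℕ → ℕ, StrictMono g ∧ (∀ i, x (g i) = some (c i)) ∧ ∀ j, j ∉ Set.range g → x j = none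

theorem ProjectsTo.range_eq {C : Type u} {x : ℕ → Option C} {c : ℕ → C} {g : ℕ → ℕ}
    (h₁ : ∀ i, x (g i) = some (c i)) (h₂ : ∀ j, j ∉ Set.range g → x j = none) :
    Set.range g = {i | (x i).isSome} := by
  ext j
  constructor
  · rintro ⟨i, rfl⟩
    simp [h₁ i]
  · intro hj
    by_contra hn
    simp [h₂ j hn] at hj

theorem ProjectsTo.unique {C : Type u} {x : ℕ → Option C} {c c' : ℕ → C}
    (h : ProjectsTo x c) (h' : ProjectsTo x c') : c = c' := by
  obtain ⟨g, hg, h₁, h₂⟩ := h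
  obtain ⟨g', hg', h₁', h₂'⟩ := h'
  have : g = g' := (hg.range_inj hg').1
    ((ProjectsTo.range_eq h₁ h₂).trans (ProjectsTo.range_eq h₁' h₂').symm)
  subst this
  funext i
  exact Option.some_injective _ ((h₁ i).symm.trans (h₁' i))

theorem ProjectsTo.infinite {C : Type u} {x : ℕ → Option C} {c : ℕ → C} (h : ProjectsTo x c) :
    {i | (x i).isSome}.Infinite := by
  obtain ⟨g, hg, h₁, h₂⟩ := h
  rw [← ProjectsTo.range_eq h₁ h₂]
  exact Set.infinite_range_of_injective hg.injective

theorem projectsTo_restrictInf {D : Type u} {C : Type v} (f : D → Option C) (x : ℕ → D)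
    (h : (keptPositions f x).Infinite) : ProjectsTo (fun i => f (x i)) (restrictInf f x h) := by
  refine ⟨Nat.nth (· ∈ keptPositions f x), Nat.nth_strictMono h, fun i => ?_, fun j hj => ?_⟩
  · exact (Option.some_get _).symm
  · have hr : Set.range (Nat.nth (· ∈ keptPositions f x)) = keptPositions f x :=
      Nat.range_nth_of_infinite h
    rw [hr] at hj
    simpa [keptPositions] using hj

theorem exists_projectsTo {C : Type u} {x : ℕ → Option C} (h : {i | (x i).isSome}.Infinite) :
    ∃ c, ProjectsTo x c :=
  ⟨_, projectsTo_restrictInf id x h⟩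

theorem exists_restrictInf_mem_iff {D : Type u} {C : Type v} (f : D → Option C) (x : ℕ → D)
    (W : Set (ℕ → C)) :
    (∃ h : (keptPositions f x).Infinite, restrictInf f x h ∈ W) ↔
      ∃ c ∈ W, ProjectsTo (fun i => f (x i)) c := by
  constructor
  · rintro ⟨h, hW⟩
    exact ⟨_, hW, projectsTo_restrictInf f x h⟩
  · rintro ⟨c, hW, hc⟩
    refine ⟨hc.infinite, ?_⟩
    rwa [(projectsTo_restrictInf f x hc.infinite).unique hc]

theorem ProjectsTo.bind {D : Type u} {C : Type v} {x : ℕ → Option D} {r : ℕ → D} {c : ℕ → C}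
    {f : D → Option C} (h : ProjectsTo x r) (h' : ProjectsTo (fun i => f (r i)) c) :
    ProjectsTo (fun i => (x i).bind f) c := by
  obtain ⟨g, hg, h₁, h₂⟩ := h
  obtain ⟨g', hg', h₁', h₂'⟩ := h'
  refine ⟨g ∘ g', hg.comp hg', fun i => by simp [h₁, h₁'], fun j hj => ?_⟩
  by_cases hj' : j ∈ Set.range g
  · obtain ⟨k, rfl⟩ := hj'
    have : k ∉ Set.range g' := by
      rintro ⟨i, rfl⟩
      exact hj ⟨i, rfl⟩
    simpa [h₁] using h₂' k this
  · simp [h₂ j hj']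

theorem ProjectsTo.finite_bind {D : Type u} {C : Type v} {x : ℕ → Option D} {r : ℕ → D}
    {f : D → Option C} (h : ProjectsTo x r) (hfin : {i | (f (r i)).isSome}.Finite) :
    {i | ((x i).bind f).isSome}.Finite := by
  obtain ⟨g, hg, h₁, h₂⟩ := h
  refine (hfin.image g).subset fun j hj => ?_
  by_cases hj' : j ∈ Set.range g
  · obtain ⟨k, rfl⟩ := hj'
    exact ⟨k, by simpa [h₁] using hj, rfl⟩
  · simp [h₂ j hj'] at hj

theorem projectsTo_some {C : Type u} (c : ℕ → C) : ProjectsTo (fun i => some (c i)) c :=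
  ⟨id, strictMono_id, fun _ => rfl, fun j hj => (hj ⟨j, rfl⟩).elim⟩

theorem projectsTo_succ_of_none {C : Type u} {x : ℕ → Option C} {c : ℕ → C} (h0 : x 0 = none) :
    ProjectsTo x c ↔ ProjectsTo (fun i => x (i + 1)) c := by
  constructor
  · rintro ⟨g, hg, h₁, h₂⟩
    have hpos : ∀ i, g i ≠ 0 := fun i hi => by simpa [hi, h0] using h₁ i
    refine ⟨fun i => g i - 1, fun i j hij => ?_, fun i => ?_, fun j hj => h₂ _ ?_⟩
    · have := hg hij
      have := hpos i
      have := hpos j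
      simp only
      omega
    · simp only
      rw [Nat.sub_add_cancel (Nat.pos_of_ne_zero (hpos i)), h₁]
    · rintro ⟨i, hi⟩
      exact hj ⟨i, by simp [hi]⟩
  · rintro ⟨g, hg, h₁, h₂⟩
    refine ⟨fun i => g i + 1, fun i j hij => by simpa using hg hij, h₁, fun j hj => ?_⟩
    cases j with
    | zero => exact h0
    | succ j =>
      refine h₂ j ?_
      rintro ⟨i, rfl⟩
      exact hj ⟨i, rfl⟩

theorem projectsTo_succ_of_some {C : Type u} {x : ℕ → Option C} {c : ℕ → C} {a : C}
    (h0 : x 0 = some a) :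
    ProjectsTo x c ↔ c 0 = a ∧ ProjectsTo (fun i => x (i + 1)) (fun i => c (i + 1)) := by
  constructor
  · rintro ⟨g, hg, h₁, h₂⟩
    have hg0 : g 0 = 0 := by
      by_contra hne
      have : 0 ∉ Set.range g := by
        rintro ⟨i, hi⟩
        have := hg.monotone (Nat.zero_le i)
        omega
      simp [h₂ 0 this] at h0
    have hpos : ∀ i, 0 < g (i + 1) := fun i => by
      have := hg (Nat.succ_pos i)
      simpa [hg0] using this
    refine ⟨?_, fun i => g (i + 1) - 1, fun i j hij => ?_, fun i => ?_, fun j hj => h₂ _ ?_⟩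
    · have := h₁ 0
      rw [hg0, h0] at this
      exact (Option.some_injective _ this).symm
    · have := hg (Nat.succ_lt_succ hij)
      have := hpos i
      have := hpos j
      simp only [Nat.succ_eq_add_one] at *
      omega
    · simp only
      rw [Nat.sub_add_cancel (hpos i), h₁]
    · rintro ⟨i, hi⟩
      cases i with
      | zero => omega
      | succ i => exact hj ⟨i, by simp [hi]⟩
  · rintro ⟨hc, g, hg, h₁, h₂⟩
    refine ⟨fun i => Nat.casesOn i 0 (fun k => g k + 1), ?_, ?_, ?_⟩
    · refine strictMono_nat_of_lt_succ fun n => ?_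
      cases n with
      | zero => simp
      | succ n => simpa using hg (Nat.lt_succ_self n)
    · intro i
      cases i with
      | zero => simp [h0, hc]
      | succ i => simpa using h₁ i
    · intro j hj
      cases j with
      | zero => exact (hj ⟨0, rfl⟩).elim
      | succ j =>
        refine h₂ j ?_
        rintro ⟨i, rfl⟩
        exact hj ⟨i + 1, rfl⟩

theorem wordAppend_cons {C : Type u} (a : C) (l : List C) (x : ℕ → C) :
    wordAppend (a :: l) x = fun i => Nat.casesOn i a (wordAppend l x) := by
  funext i
  cases i with
  | zero => simp [wordAppend]
  | succ i => simp [wordAppend]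

theorem prefixIndependent_iff {C : Type u} {W : Set (ℕ → C)} :
    PrefixIndependent W ↔ ∀ x : ℕ → C, x ∈ W ↔ (fun i => x (i + 1)) ∈ W := by
  constructor
  · intro h x
    rw [← h [x 0] (fun i => x (i + 1)), wordAppend_cons]
    refine iff_of_eq (congrArg (· ∈ W) ?_)
    funext i
    cases i with
    | zero => rfl
    | succ i => simp [wordAppend]
  · intro h l x
    induction l with
    | nil =>
      refine iff_of_eq (congrArg (· ∈ W) ?_)
      funext i
      simp [wordAppend]
    | cons a l ih => rw [h, wordAppend_cons, ← ih]

/-- The words over `C ⊔ {ε}` whose projection to `C` is finite or belongs to `W`. -/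
def hat {C : Type u} (W : Set (ℕ → C)) : Set (ℕ → Option C) :=
  {x | ∀ c, ProjectsTo x c → c ∈ W}

theorem mem_hat_succ_iff {C : Type u} {W : Set (ℕ → C)} (hW : PrefixIndependent W)
    (x : ℕ → Option C) : x ∈ hat W ↔ (fun i => x (i + 1)) ∈ hat W := by
  rw [prefixIndependent_iff] at hW
  cases h0 : x 0 with
  | none => exact forall_congr' fun c => by rw [projectsTo_succ_of_none h0]
  | some a =>
    constructor
    · intro h c hc
      have := h (fun i => Nat.casesOn i a c) ((projectsTo_succ_of_some h0).2 ⟨rfl, hc⟩)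
      exact (hW _).1 this
    · intro h c hc
      exact (hW _).2 (h _ ((projectsTo_succ_of_some h0).1 hc).2)

theorem mem_hat_add_iff {C : Type u} {W : Set (ℕ → C)} (hW : PrefixIndependent W)
    (x : ℕ → Option C) (N : ℕ) : x ∈ hat W ↔ (fun i => x (i + N)) ∈ hat W := by
  induction N with
  | zero => rfl
  | succ N ih =>
    rw [ih, mem_hat_succ_iff hW]
    simp only [Nat.add_right_comm _ 1 N, Nat.add_assoc]

theorem some_mem_hat_iff {C : Type u} {W : Set (ℕ → C)} (c : ℕ → C) :
    (fun i => some (c i)) ∈ hat W ↔ c ∈ W :=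
  ⟨fun h => h c (projectsTo_some c), fun h c' hc' => by rwa [← (projectsTo_some c).unique hc']⟩

theorem nonempty_of_epsExtension_nonempty {C : Type u} {W : Set (ℕ → C)}
    (h : (epsExtension W).Nonempty) : W.Nonempty := by
  obtain ⟨x, ⟨_, hx⟩ | ⟨_, _, y, hy⟩⟩ := h
  · exact ⟨_, hx⟩
  · exact ⟨_, hy⟩

/-- Prefix independence makes the finite projection irrelevant: any word of `W` completes it. Hence
nonemptiness is needed: the `ε`-extension of `∅` is empty, whereas `hat ∅` contains every word with
finite projection. -/
theorem epsExtension_eq_hat {C : Type u} {W : Set (ℕ → C)} (hW : PrefixIndependent W)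
    (hne : W.Nonempty) : epsExtension W = hat W := by
  ext x
  constructor
  · rintro (hx | ⟨N, hN, -⟩) c hc
    · obtain ⟨c', hc', hp⟩ := (exists_restrictInf_mem_iff id x W).1 hx
      rwa [hc.unique hp]
    · refine (hc.infinite ((Set.finite_lt_nat N).subset fun i hi => ?_)).elim
      by_contra hi'
      simp [hN i (not_lt.1 hi')] at hi
  · intro hx
    by_cases hinf : {i | (x i).isSome}.Infinite
    · obtain ⟨c, hc⟩ := exists_projectsTo hinf
      exact Or.inl ((exists_restrictInf_mem_iff id x W).2 ⟨c, hx c hc, hc⟩)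
    · obtain ⟨N, hN⟩ := (Set.not_infinite.1 hinf).bddAbove
      obtain ⟨y, hy⟩ := hne
      refine Or.inr ⟨N + 1, fun i hi => ?_, y, (hW _ _).2 hy⟩
      by_contra hi'
      have := hN (Option.isSome_iff_ne_none.2 hi')
      omega

/-! ### Words of a lexicographic product -/

theorem mem_lexProduct_iff {C₁ C₂ : Type u} {W₁ : Set (ℕ → C₁)} {W₂ : Set (ℕ → C₂)}
    (r : ℕ → C₁ ⊕ C₂) : r ∈ lexProduct W₁ W₂ ↔
      (∃ c ∈ W₂, ProjectsTo (fun i => (r i).getRight?) c) ∨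
      ({i | (r i).getRight?.isSome}.Finite ∧ ∃ c ∈ W₁, ProjectsTo (fun i => (r i).getLeft?) c) := by
  rw [← exists_restrictInf_mem_iff, ← exists_restrictInf_mem_iff]
  rfl

/-- Erasures compose, so both conditions can be read on `x` itself. In `hat`, finite projections are
harmless, so the infinitude of the `C₁`-part need not be required. -/
theorem mem_hat_lexProduct_iff {C₁ C₂ : Type u} {W₁ : Set (ℕ → C₁)} {W₂ : Set (ℕ → C₂)}
    (x : ℕ → Option (C₁ ⊕ C₂)) : x ∈ hat (lexProduct W₁ W₂) ↔
      (fun i => (x i).bind Sum.getRight?) ∈ hat W₂ ∧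
      ({i | ((x i).bind Sum.getRight?).isSome}.Finite →
        (fun i => (x i).bind Sum.getLeft?) ∈ hat W₁) := by
  have hsub : ∀ {D : Type u} (f : C₁ ⊕ C₂ → Option D),
      {i | ((x i).bind f).isSome} ⊆ {i | (x i).isSome} := by
    intro D f i hi
    cases h : x i <;> simp_all
  constructor
  · refine fun hx => ⟨fun c hc => ?_, fun hfin c hc => ?_⟩
    · obtain ⟨r, hr⟩ := exists_projectsTo (hc.infinite.mono (hsub _))
      have hinf : {i | ((r i).getRight?).isSome}.Infinite := fun h =>
        hc.infinite (hr.finite_bind h)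
      obtain ⟨c₂, hc₂, hp⟩ | ⟨hf, -⟩ := (mem_lexProduct_iff r).1 (hx r hr)
      · rwa [hc.unique (hr.bind hp)]
      · exact (hinf hf).elim
    · obtain ⟨r, hr⟩ := exists_projectsTo (hc.infinite.mono (hsub _))
      obtain ⟨c₂, hc₂, hp⟩ | ⟨-, c₁, hc₁, hp⟩ := (mem_lexProduct_iff r).1 (hx r hr)
      · exact ((hr.bind hp).infinite hfin).elim
      · rwa [hc.unique (hr.bind hp)]
  · rintro ⟨h₂, h₁⟩ r hr
    rw [mem_lexProduct_iff]
    by_cases hinf : {i | ((r i).getRight?).isSome}.Infinite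
    · obtain ⟨c, hc⟩ := exists_projectsTo hinf
      exact Or.inl ⟨c, h₂ c (hr.bind hc), hc⟩
    · have hfin := Set.not_infinite.1 hinf
      have hinf' : {i | ((r i).getLeft?).isSome}.Infinite := by
        refine hfin.infinite_compl.mono fun i hi => ?_
        cases h : r i <;> simp_all
      obtain ⟨c, hc⟩ := exists_projectsTo hinf'
      exact Or.inr ⟨hfin, c, h₁ (hr.finite_bind hfin) c (hr.bind hc), hc⟩

theorem finite_setOf_succ_iff (P : ℕ → Prop) : {i | P (i + 1)}.Finite ↔ {i | P i}.Finite := by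
  constructor
  · intro h
    refine ((h.image (· + 1)).insert 0).subset fun i hi => ?_
    cases i with
    | zero => simp
    | succ i => exact Or.inr ⟨i, hi, rfl⟩
  · intro h
    exact h.preimage (f := (· + 1)) (by simp)

theorem PrefixIndependent.lexProduct {C₁ C₂ : Type u} {W₁ : Set (ℕ → C₁)} {W₂ : Set (ℕ → C₂)}
    (h₁ : PrefixIndependent W₁) (h₂ : PrefixIndependent W₂) :
    PrefixIndependent (lexProduct W₁ W₂) := by
  rw [prefixIndependent_iff]
  intro x
  rw [← some_mem_hat_iff x, ← some_mem_hat_iff fun i => x (i + 1), mem_hat_lexProduct_iff, mem_hat_lexProduct_iff,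
    mem_hat_succ_iff h₂, mem_hat_succ_iff h₁, finite_setOf_succ_iff
      (fun i => ((some (x i)).bind Sum.getRight?).isSome = true)]

/-! ### Graphs with `ε`-edges -/

section Graphs

variable {X : Type u} {Y : Type v} {C : Type w}

/-- All paths of the graph `E` are labelled by words of `hat W`. -/
def AllSat (E : X → Option C → X → Prop) (W : Set (ℕ → C)) : Prop :=
  ∀ (p : ℕ → X) (x : ℕ → Option C), (∀ i, E (p i) (x i) (p (i + 1))) → x ∈ hat W

/-- All paths from `s` in the graph `E` are labelled by words of `hat W`. -/
def SatFrom (E : X → Option C → X → Prop) (W : Set (ℕ → C)) (s : X) : Prop :=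
  ∀ (p : ℕ → X) (x : ℕ → Option C), p 0 = s → (∀ i, E (p i) (x i) (p (i + 1))) → x ∈ hat W

/-- Paths of `ε`-edges. -/
def EpsReach (E : X → Option C → X → Prop) : X → X → Prop :=
  Relation.ReflTransGen fun a b => E a none b

/-- Paths labelled by `ε* o ε*`. -/
def WeakStep (E : X → Option C → X → Prop) (o : Option C) (x y : X) : Prop :=
  ∃ z z', EpsReach E x z ∧ E z o z' ∧ EpsReach E z' y

theorem EpsReach.exists_walk {E : X → Option C → X → Prop} {x y : X} (h : EpsReach E x y) :
    ∃ (n : ℕ) (q : ℕ → X), q 0 = x ∧ q n = y ∧ ∀ k < n, E (q k) none (q (k + 1)) := by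
  induction h with
  | refl => exact ⟨0, fun _ => x, rfl, rfl, by simp⟩
  | @tail b c _ hbc ih =>
    obtain ⟨n, q, h0, hn, hq⟩ := ih
    refine ⟨n + 1, fun k => if k ≤ n then q k else c, by simp [h0], by simp, fun k hk => ?_⟩
    obtain rfl | hk' := (Nat.lt_succ_iff.1 hk).eq_or_lt
    · simpa [hn] using hbc
    · simpa [hk'.le, Nat.succ_le_of_lt hk'] using hq k hk'

theorem WeakStep.exists_walk {E : X → Option C → X → Prop} {o : Option C} {x y : X}
    (h : WeakStep E o x y) :
    ∃ (n j : ℕ) (q : ℕ → X), j < n ∧ q 0 = x ∧ q n = y ∧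
      ∀ k < n, E (q k) (if k = j then o else none) (q (k + 1)) := by
  obtain ⟨z, z', h₁, h₂, h₃⟩ := h
  obtain ⟨n₁, q₁, h₁0, h₁n, hq₁⟩ := h₁.exists_walk
  obtain ⟨n₃, q₃, h₃0, h₃n, hq₃⟩ := h₃.exists_walk
  refine ⟨n₁ + 1 + n₃, n₁, fun k => if k ≤ n₁ then q₁ k else q₃ (k - (n₁ + 1)), by omega,
    by simp [h₁0], ?_, fun k hk => ?_⟩
  · have : ¬ n₁ + 1 + n₃ ≤ n₁ := by omega
    simp [this, h₃n]
  · rcases lt_trichotomy k n₁ with hlt | rfl | hgt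
    · simpa [hlt.le, Nat.succ_le_of_lt hlt, hlt.ne] using hq₁ k hlt
    · simpa [h₁n, h₃0] using h₂
    · have h1 : ¬ k ≤ n₁ := by omega
      have h2 : ¬ k + 1 ≤ n₁ := by omega
      have h3 : k + 1 - (n₁ + 1) = k - (n₁ + 1) + 1 := by omega
      simp only [h1, h2, if_false, hgt.ne', h3]
      exact hq₃ _ (by omega)

/-- The walks are concatenated: the `i`-th one occupies the times from `S i` to `S (i + 1)`, `b`
gives the block of a time, and `j i` is the offset of the letter `c i` in its block. Blocks are
nonempty because `j i < n i`. -/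
theorem exists_path_of_weakSteps {E : X → Option C → X → Prop} {p : ℕ → X} {c : ℕ → C}
    (h : ∀ i, WeakStep E (some (c i)) (p i) (p (i + 1))) :
    ∃ (q : ℕ → X) (x : ℕ → Option C), (∀ i, E (q i) (x i) (q (i + 1))) ∧ ProjectsTo x c := by
  choose n j q hjn hq0 hqn hq using fun i => (h i).exists_walk
  let S : ℕ → ℕ := fun i => ∑ k ∈ Finset.range i, n k
  have hS0 : S 0 = 0 := rfl
  have hS : ∀ i, S (i + 1) = S i + n i := fun i => Finset.sum_range_succ _ _
  have hmono : StrictMono S := strictMono_nat_of_lt_succ fun i => by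
    have := hjn i
    rw [hS]
    omega
  have hex : ∀ i, ∃ b, S b ≤ i ∧ i < S (b + 1) := by
    intro i
    induction i with
    | zero => exact ⟨0, by simp [hS0], by have := hjn 0; rw [hS, hS0]; omega⟩
    | succ i ih =>
      obtain ⟨b, h1, h2⟩ := ih
      by_cases h3 : i + 1 < S (b + 1)
      · exact ⟨b, by omega, h3⟩
      · exact ⟨b + 1, by omega, by have := hmono (Nat.lt_succ_self (b + 1)); grind⟩
  have huniq : ∀ i b b', S b ≤ i → i < S (b + 1) → S b' ≤ i → i < S (b' + 1) → b = b' := by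
    intro i b b' h1 h2 h3 h4
    have h5 : b < b' + 1 := hmono.lt_iff_lt.1 (by omega)
    have h6 : b' < b + 1 := hmono.lt_iff_lt.1 (by omega)
    omega
  choose b hb1 hb2 using hex
  refine ⟨fun i => q (b i) (i - S (b i)),
    fun i => if i - S (b i) = j (b i) then some (c (b i)) else none, fun i => ?_, ?_⟩
  · have hlt : i - S (b i) < n (b i) := by
      have := hb1 i
      have := hb2 i
      rw [hS] at this
      omega
    have hstep := hq (b i) _ hlt
    suffices hnext : q (b (i + 1)) (i + 1 - S (b (i + 1))) = q (b i) (i - S (b i) + 1) by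
      rw [← hnext] at hstep
      exact hstep
    have h1 := hb1 i
    by_cases h3 : i + 1 < S (b i + 1)
    · rw [huniq (i + 1) (b (i + 1)) (b i) (hb1 _) (hb2 _) (by omega) h3,
        Nat.sub_add_comm h1]
    · have h2 := hb2 i
      have h4 : i + 1 = S (b i + 1) := by omega
      rw [huniq (i + 1) (b (i + 1)) (b i + 1) (hb1 _) (hb2 _) (by omega)
        (h4 ▸ hmono (Nat.lt_succ_self _)), ← h4, Nat.sub_self, hq0, ← hqn]
      congr 1
      rw [hS] at h4
      omega
  · have hbS : ∀ i, b (S i + j i) = i := fun i =>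
      huniq (S i + j i) _ _ (hb1 _) (hb2 _) (by omega) (by rw [hS]; have := hjn i; omega)
    refine ⟨fun i => S i + j i, strictMono_nat_of_lt_succ fun i => ?_, fun i => ?_, fun k hk => ?_⟩
    · have := hjn i
      rw [hS]
      omega
    · simp [hbS]
    · refine if_neg fun hk' => hk ⟨b k, ?_⟩
      have := hb1 k
      simp only
      omega

/-- Simulation of a graph, up to additional `ε`-edges, from the sources of the `C`-edges on. -/
theorem AllSat.of_simulation {E : X → Option C → X → Prop} {E' : Y → Option C → Y → Prop}
    {W : Set (ℕ → C)} (hsat : AllSat E' W) (τ : X → Y) (P : X → Prop)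
    (hP : ∀ a c b, E a (some c) b → P a) (hP' : ∀ a o b, E a o b → P a → P b)
    (hnone : ∀ a b, E a none b → P a → EpsReach E' (τ a) (τ b))
    (hsome : ∀ a c b, E a (some c) b → WeakStep E' (some c) (τ a) (τ b)) : AllSat E W := by
  rintro p x hp c ⟨g, hg, h₁, h₂⟩
  -- The `ε`-edges before the first letter, at time `g 0`, need not be simulated; `P` holds from
  -- then on.
  have hPp : ∀ k, P (p (g 0 + k)) := by
    intro k
    induction k with
    | zero => exact hP _ (c 0) _ (h₁ 0 ▸ hp (g 0))
    | succ k ih => exact hP' _ _ _ (hp _) ih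
  -- The `ε`-edges between two consecutive letters are absorbed into the weak step of the first one.
  have hstep : ∀ i, WeakStep E' (some (c i)) (τ (p (g i))) (τ (p (g (i + 1)))) := by
    intro i
    have heps : ∀ k, g i + 1 + k ≤ g (i + 1) →
        EpsReach E' (τ (p (g i + 1))) (τ (p (g i + 1 + k))) := by
      intro k
      induction k with
      | zero => exact fun _ => .refl
      | succ k ih =>
        intro hk
        refine (ih (by omega)).trans (hnone _ _ ?_ ?_)
        · have hx : x (g i + 1 + k) = none := by
            refine h₂ _ ?_
            rintro ⟨i', hi'⟩
            have h5 : i < i' := hg.lt_iff_lt.1 (by omega)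
            have h6 : i' < i + 1 := hg.lt_iff_lt.1 (by omega)
            omega
          exact hx ▸ hp (g i + 1 + k)
        · have := hg.monotone (Nat.zero_le i)
          have h7 := hPp (g i + 1 + k - g 0)
          rwa [Nat.add_sub_cancel' (by omega)] at h7
    have hlt := hg (Nat.lt_succ_self i)
    have hlast := heps (g (i + 1) - (g i + 1)) (by grind)
    rw [Nat.add_sub_cancel' hlt] at hlast
    obtain ⟨z, z', hz, hzz, hz'⟩ := hsome _ _ _ (h₁ i ▸ hp (g i))
    exact ⟨z, z', hz, hzz, hz'.trans hlast⟩
  obtain ⟨q, y, hq, hy⟩ := exists_path_of_weakSteps hstep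
  exact hsat q y hq c hy

theorem WeakStep.of_edge {E : X → Option C → X → Prop} {o : Option C} {x y : X} (h : E x o y) :
    WeakStep E o x y :=
  ⟨x, y, .refl, h, .refl⟩

theorem SatFrom.edge {E : X → Option C → X → Prop} {W : Set (ℕ → C)} (hW : PrefixIndependent W)
    {s s' : X} {o : Option C} (h : SatFrom E W s) (he : E s o s') : SatFrom E W s' := by
  intro p x hp0 hp
  refine (mem_hat_succ_iff hW (fun i => Nat.casesOn i o x)).1
    (h (fun i => Nat.casesOn i s p) _ rfl fun i => ?_)
  cases i with
  | zero => simpa [hp0] using he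
  | succ i => exact hp i

theorem allSat_of_satFrom {E : X → Option C → X → Prop} {W : Set (ℕ → C)}
    {E' : X → Option C → X → Prop} (h : ∀ a o b, E' a o b → E a o b ∧ SatFrom E W a) :
    AllSat E' W :=
  fun p x hp => (h _ _ _ (hp 0)).2 p x rfl fun i => (h _ _ _ (hp i)).1

end Graphs

/-! ### Ordering the vertices of a graph -/

/-- The graph `E` with an `ε`-edge added from `x` to `y` whenever `m x = m y` and `o y ≤ o x`. -/
def withOrder {X : Type u} {C : Type v} {α : Type w} {M : Type u} [LE α]
    (E : X → Option C → X → Prop) (o : X → α) (m : X → M) : X → Option C → X → Prop :=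
  fun x c y => E x c y ∨ (c = none ∧ m x = m y ∧ o y ≤ o x)

/-- The graph `E` is compatible with the order on the fibres of `m` induced by `o`: its `ε`-edges
are nonincreasing, and all paths with additional nonincreasing `ε`-edges satisfy `W`. -/
structure IsOrdering {X : Type u} {C : Type v} {α : Type w} {M : Type u} [LE α]
    (E : X → Option C → X → Prop) (W : Set (ℕ → C)) (o : X → α) (m : X → M) : Prop where
  eps : ∀ x y, E x none y → m x = m y ∧ o y ≤ o x
  sat : AllSat (withOrder E o m) W

/-- A forest on lists: edges append a letter at the head and have a unique colour. -/
structure IsForest {B : Type u} {C : Type v} (E : List B → Option C → List B → Prop) : Prop where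
  exists_eq_cons : ∀ l o l', E l o l' → ∃ b, l' = b :: l
  colour_unique : ∀ l o o' l', E l o l' → E l o' l' → o = o'

/-- Every forest satisfying `W` has a well-founded ordering with at most `μ` fibres. -/
def HasOrderings {C : Type u} (W : Set (ℕ → C)) (μ : Cardinal.{u}) : Prop :=
  ∀ (B : Type u) (E : List B → Option C → List B → Prop), IsForest E → AllSat E W →
    ∃ (M : Type u) (α : Type (u + 1)) (_ : LinearOrder α) (_ : WellFoundedLT α)
      (o : List B → α) (m : List B → M), #M ≤ μ ∧ IsOrdering E W o m

theorem HasOrderings.lexProduct {C₁ C₂ : Type u} {W₁ : Set (ℕ → C₁)} {W₂ : Set (ℕ → C₂)}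
    {μ₁ μ₂ : Cardinal.{u}} (hW₁ : PrefixIndependent W₁)
    (h₁ : HasOrderings W₁ μ₁) (h₂ : HasOrderings W₂ μ₂) :
    HasOrderings (lexProduct W₁ W₂) (μ₁ * μ₂) := by
  intro B E hE hsat
  -- For `W₂`, the letters of `C₁` become `ε`; for `W₁`, the edges with letters of `C₂` are deleted.
  let E₂ : List B → Option C₂ → List B → Prop :=
    fun l o l' => ∃ d, E l d l' ∧ d.bind Sum.getRight? = o
  let E₁ : List B → Option C₁ → List B → Prop := fun l o l' => E l (o.map Sum.inl) l'
  have hE₂ : IsForest E₂ := by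
    refine ⟨fun l o l' ⟨d, hd, _⟩ => hE.exists_eq_cons l d l' hd, ?_⟩
    rintro l _ _ l' ⟨d, hd, rfl⟩ ⟨d', hd', rfl⟩
    rw [hE.colour_unique l d d' l' hd hd']
  have hE₁ : IsForest E₁ := by
    refine ⟨fun l o l' hd => hE.exists_eq_cons l _ l' hd, fun l o o' l' hd hd' => ?_⟩
    exact Option.map_injective Sum.inl_injective (hE.colour_unique l _ _ l' hd hd')
  have hsat₂ : AllSat E₂ W₂ := by
    intro p x hp
    choose d hd hdx using hp
    have := ((mem_hat_lexProduct_iff d).1 (hsat p d hd)).1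
    simpa only [hdx] using this
  have hsat₁ : AllSat E₁ W₁ := by
    intro p x hp
    have hR : ∀ i, ((x i).map Sum.inl).bind (Sum.getRight? (α := C₁) (β := C₂)) = none := by
      intro i
      cases x i <;> rfl
    have hL : ∀ i, ((x i).map Sum.inl).bind (Sum.getLeft? (α := C₁) (β := C₂)) = x i := by
      intro i
      cases x i <;> rfl
    have := ((mem_hat_lexProduct_iff _).1 (hsat p _ hp)).2 (by simp [hR])
    simpa only [hL] using this
  obtain ⟨M₁, α₁, _, _, o₁, m₁, hM₁, ho₁⟩ := h₁ B E₁ hE₁ hsat₁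
  obtain ⟨M₂, α₂, _, _, o₂, m₂, hM₂, ho₂⟩ := h₂ B E₂ hE₂ hsat₂
  refine ⟨M₁ × M₂, α₂ ×ₗ α₁, inferInstance, inferInstance, fun l => toLex (o₂ l, o₁ l),
    fun l => (m₁ l, m₂ l), ?_, fun l l' hl => ?_, fun p x hp => ?_⟩
  · rw [Cardinal.mk_prod, Cardinal.lift_id, Cardinal.lift_id]
    exact mul_le_mul' hM₁ hM₂
  · obtain ⟨hm₁, hl₁⟩ := ho₁.eps l l' hl
    obtain ⟨hm₂, hl₂⟩ := ho₂.eps l l' ⟨none, hl, rfl⟩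
    refine ⟨by simp [hm₁, hm₂], Prod.Lex.toLex_le_toLex.2 ?_⟩
    exact hl₂.lt_or_eq.imp_right fun h => ⟨h, hl₁⟩
  · have hstep₂ : ∀ i, withOrder E₂ o₂ m₂ (p i) ((x i).bind Sum.getRight?) (p (i + 1)) := by
      intro i
      obtain h | ⟨hx, hm, ho⟩ := hp i
      · exact Or.inl ⟨_, h, rfl⟩
      · refine Or.inr ⟨by simp [hx], (Prod.ext_iff.1 hm).2, ?_⟩
        exact (Prod.Lex.toLex_le_toLex.1 ho).elim le_of_lt fun h => h.1.le
    rw [mem_hat_lexProduct_iff]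
    refine ⟨ho₂.sat p _ hstep₂, fun hfin => ?_⟩
    obtain ⟨N, hN⟩ := hfin.bddAbove
    have hnone : ∀ i, N < i → (x i).bind Sum.getRight? = none := by
      intro i hi
      by_contra hne
      exact (hN (Option.isSome_iff_ne_none.2 hne)).not_gt hi
    have hanti : Antitone fun i => o₂ (p (i + (N + 1))) := by
      refine antitone_nat_of_succ_le fun i => ?_
      have := hstep₂ (i + (N + 1))
      rw [hnone _ (by omega)] at this
      rw [Nat.add_right_comm i 1 (N + 1)]
      exact this.elim (fun h => (ho₂.eps _ _ h).2) fun h => h.2.2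
    -- Past the last `C₂`-letter every edge is an `ε`-edge for `W₂`, so the first rank is
    -- nonincreasing, hence eventually constant by well-foundedness.
    obtain ⟨K, hK⟩ := WellFoundedLT.antitone_chain_condition hanti
    rw [mem_hat_add_iff hW₁ _ (K + (N + 1))]
    refine ho₁.sat (fun i => p (i + (K + (N + 1)))) _ fun i => ?_
    have hi : i + 1 + (K + (N + 1)) = i + (K + (N + 1)) + 1 := by omega
    simp only [hi]
    obtain h | ⟨hx, hm, ho⟩ := hp (i + (K + (N + 1)))
    · refine Or.inl ?_
      have := hnone (i + (K + (N + 1))) (by omega)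
      have hx : ((x (i + (K + (N + 1)))).bind Sum.getLeft?).map Sum.inl =
          x (i + (K + (N + 1))) := by
        revert this
        rcases x (i + (K + (N + 1))) with _ | a | a <;> simp
      simpa only [E₁, hx] using h
    · refine Or.inr ⟨by simp [hx], (Prod.ext_iff.1 hm).1, ?_⟩
      -- With the first rank constant, an added edge can only be nonincreasing through the second
      -- rank.
      refine ((Prod.Lex.toLex_le_toLex.1 ho).resolve_left fun h => h.ne ?_).2
      have h1 := hK (i + K) (by omega)
      have h2 := hK (i + 1 + K) (by omega)
      have h3 := h2.symm.trans h1
      convert h3 using 3 <;> omega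

/-! ### Orderings from memory -/

/-- The rank of `y` is the supremum of the successors of the ranks below it, so it is monotone in
the set of predecessors. -/
theorem exists_rank {X : Type u} {r : X → X → Prop} (hr : WellFounded r) :
    ∃ o : X → Ordinal.{u}, (∀ x y, r x y → o x < o y) ∧
      ∀ x y, (∀ z, r z y → r z x) → o y ≤ o x := by
  have : IsWellFounded X r := ⟨hr⟩
  refine ⟨IsWellFounded.rank r, fun x y h => IsWellFounded.rank_lt_of_rel h, fun x y h => ?_⟩
  rw [IsWellFounded.rank_eq r y]
  exact Ordinal.iSup_le fun z => Order.succ_le_of_lt (IsWellFounded.rank_lt_of_rel (h z z.2))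

/-- Treated apart because `epsExtension ∅` is not `hat ∅`. No path carries infinitely many letters,
so a rank exists that drops strictly at each letter and never rises along `ε`; one fibre suffices.
-/
theorem hasOrderings_empty {C : Type u} {μ : Cardinal.{u}} (hμ : 1 ≤ μ) :
    HasOrderings (∅ : Set (ℕ → C)) μ := by
  intro B E _ hsat
  have hwf : WellFounded fun l' l : List B => ∃ c, WeakStep E (some c) l l' := by
    rw [wellFounded_iff_isEmpty_descending_chain]
    refine ⟨fun ⟨p, hp⟩ => ?_⟩
    choose c hc using hp
    obtain ⟨q, x, hq, hx⟩ := exists_path_of_weakSteps hc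
    exact hsat q x hq c hx
  obtain ⟨o, ho, ho'⟩ := exists_rank hwf
  have heps : ∀ x y, E x none y → o y ≤ o x := fun x y h =>
    ho' _ _ fun _ ⟨c, z, z', hz⟩ => ⟨c, z, z', .head h hz.1, hz.2⟩
  refine ⟨PUnit, Ordinal.{u}, inferInstance, inferInstance, o, fun _ => PUnit.unit, by simpa using hμ,
    fun x y h => ⟨rfl, heps x y h⟩, ?_⟩
  rintro p x hp c ⟨g, hg, h₁, -⟩
  have hsome : ∀ i c, x i = some c → o (p (i + 1)) < o (p i) := by
    intro i c hc
    have := hp i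
    rw [hc] at this
    exact ho _ _ ⟨c, .of_edge (this.resolve_right fun h => by simp at h)⟩
  have hanti : Antitone fun i => o (p i) := by
    refine antitone_nat_of_succ_le fun i => ?_
    cases hx : x i with
    | some c => exact (hsome i c hx).le
    | none =>
      have := hp i
      rw [hx] at this
      exact this.elim (heps _ _) fun h => h.2.2
  obtain ⟨n, hn⟩ := WellFoundedLT.antitone_chain_condition hanti
  have hgn := hg.le_apply (x := n)
  exact ((hsome _ _ (h₁ n)).ne ((hn _ (by omega)).symm.trans (hn _ hgn))).elim

/-- A vertex `b :: l` has no possible predecessor but `l`, and by a single colour, so states can be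
chosen by recursion on the list without conflicts. This is why forests are used. -/
theorem IsForest.exists_lift {B X : Type u} {C : Type v} {E : List B → Option C → List B → Prop}
    (hE : IsForest E) (F : X → Option C → X → Prop) (P : List B → X → Prop)
    (hroot : ∀ l, ∃ s, P l s)
    (hstep : ∀ l s o l', P l s → E l o l' → ∃ s', P l' s' ∧ F s o s') :
    ∃ st : List B → X, (∀ l, P l (st l)) ∧ ∀ l o l', E l o l' → F (st l) o (st l') := by
  classical
  have hcons : ∀ b l (s : {s // P l s}), ∃ s' : {s // P (b :: l) s},
      ∀ o, E l o (b :: l) → F s o s' := by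
    intro b l s
    by_cases h : ∃ o, E l o (b :: l)
    · obtain ⟨o, ho⟩ := h
      obtain ⟨s', hs', hF⟩ := hstep l s o _ s.2 ho
      exact ⟨⟨s', hs'⟩, fun o' ho' => hE.colour_unique _ _ _ _ ho ho' ▸ hF⟩
    · obtain ⟨s', hs'⟩ := hroot (b :: l)
      exact ⟨⟨s', hs'⟩, fun o ho => (h ⟨o, ho⟩).elim⟩
  choose next hnext using hcons
  obtain ⟨s₀, hs₀⟩ := hroot []
  let st : ∀ l, {s // P l s} := fun l => List.rec ⟨s₀, hs₀⟩ (fun b l s => next b l s) l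
  refine ⟨fun l => (st l).1, fun l => (st l).2, fun l o l' h => ?_⟩
  obtain ⟨b, rfl⟩ := hE.exists_eq_cons l o l' h
  exact hnext b l (st l) o h

/-- The edges of the game in which Adam moves along the edges of `E`, and may propose at any time
a set of vertices containing the current one, in which Eve then chooses a vertex. The initial
vertex is the empty set, from which Adam chooses any vertex. -/
inductive ChoiceEdge {X C : Type u} (E : X → Option C → X → Prop) :
    X ⊕ Set X → Option C → X ⊕ Set X → Prop
  | edge {x o y} (h : E x o y) : ChoiceEdge E (.inl x) o (.inl y)
  | propose {x A} (h : x ∈ A) : ChoiceEdge E (.inl x) none (.inr A)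
  | choose {x A} (h : x ∈ A) : ChoiceEdge E (.inr A) none (.inl x)
  | start {x} : ChoiceEdge E (.inr ∅) none (.inl x)

/-- The arena of the game described at `ChoiceEdge`. -/
def choiceArena {X C : Type u} [Nonempty X] (E : X → Option C → X → Prop) :
    Arena (X ⊕ Set X) (Option C) where
  Edge := ChoiceEdge E
  exists_edge := by
    rintro (x | A)
    · exact ⟨none, _, .propose (Set.mem_singleton x)⟩
    · obtain rfl | ⟨x, hx⟩ := A.eq_empty_or_nonempty
      · exact ⟨none, _, .start (x := Classical.arbitrary X)⟩
      · exact ⟨none, _, .choose hx⟩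
  eve := {x | ∃ A : Set X, A.Nonempty ∧ x = .inr A}
  init := .inr ∅

/-- The states of the strategy in the game of `ChoiceEdge` in which Eve goes back to the vertex
from which the set was proposed. -/
inductive ReturnState (X : Type u) : Type u
  | start
  | vertex (x : X)
  | proposal (x : X) (A : Set X) (h : x ∈ A)

/-- The edges of the strategy described at `ReturnState`. -/
inductive ReturnEdge {X C : Type u} (E : X → Option C → X → Prop) :
    ReturnState X → Option C → ReturnState X → Prop
  | edge {x o y} (h : E x o y) : ReturnEdge E (.vertex x) o (.vertex y)
  | propose {x A} (h : x ∈ A) : ReturnEdge E (.vertex x) none (.proposal x A h)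
  | back {x A} {h : x ∈ A} : ReturnEdge E (.proposal x A h) none (.vertex x)
  | start {x} : ReturnEdge E .start none (.vertex x)

/-- The projection of the strategy described at `ReturnState`. -/
def ReturnState.proj {X : Type u} : ReturnState X → X ⊕ Set X
  | .start => .inr ∅
  | .vertex x => .inl x
  | .proposal _ A _ => .inr A

/-- The vertex of the graph recorded by a state. -/
noncomputable def ReturnState.base {X : Type u} [Nonempty X] : ReturnState X → X
  | .start => Classical.arbitrary X
  | .vertex x => x
  | .proposal x _ _ => x

/-- The strategy described at `ReturnState`. -/
def returnStrategy {X C : Type u} [Nonempty X] (E : X → Option C → X → Prop) :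
    Strategy (choiceArena E) (ReturnState X) where
  Edge := ReturnEdge E
  exists_edge := by
    rintro (_ | x | ⟨x, A, h⟩)
    · exact ⟨none, .vertex (Classical.arbitrary X), .start⟩
    · exact ⟨none, _, .propose (Set.mem_singleton x)⟩
    · exact ⟨none, _, .back⟩
  proj := ReturnState.proj
  init := .start
  proj_edge := by
    rintro _ _ _ (h | h | _ | _)
    · exact .edge h
    · exact .propose h
    · exact .choose ‹_›
    · exact .start
  proj_init := rfl
  adam := by
    rintro (_ | x | ⟨x, A, hx⟩) c y hs h
    · obtain _ | _ | h := h
      · exact h.elim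
      · exact ⟨_, rfl, .start⟩
    · obtain h | h := h
      · exact ⟨_, rfl, .edge h⟩
      · exact ⟨_, rfl, .propose ‹_›⟩
    · exact (hs ⟨A, ⟨x, hx⟩, rfl⟩).elim

/-- A proposal followed by a return does not move the base vertex. The start state is excluded
because its `ε`-edges jump to arbitrary vertices. -/
theorem allSat_returnEdge {X C : Type u} [Nonempty X] {E : X → Option C → X → Prop}
    {W : Set (ℕ → C)} (h : AllSat E W) : AllSat (ReturnEdge E) W := by
  refine h.of_simulation ReturnState.base (fun s => s ≠ .start) ?_ ?_ ?_ ?_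
  · rintro _ c _ (_ | _)
    simp
  · rintro _ _ _ (_ | _ | _ | _) _
    all_goals simp
  · rintro _ _ (h | _ | _ | _) hs
    · exact .single h
    · exact .refl
    · exact .refl
    · exact (hs rfl).elim
  · rintro _ _ _ (h | _)
    exact .of_edge h

theorem HasEpsMemoryLE.one_le {C : Type u} {W : Set (ℕ → C)} {μ : Cardinal.{u}}
    (h : HasEpsMemoryLE W μ) : 1 ≤ μ := by
  obtain ⟨M, A, σ, hM, -⟩ := h PUnit
    { Edge := fun _ _ _ => True, exists_edge := fun _ => ⟨none, PUnit.unit, trivial⟩, eve := ∅,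
      init := PUnit.unit }
  have : Nonempty M := ⟨σ.init.1.2⟩
  exact (Cardinal.one_le_iff_ne_zero.2 (Cardinal.mk_ne_zero M)).trans hM

theorem HasEpsMemoryLE.hasOrderings {C : Type u} {W : Set (ℕ → C)} {μ : Cardinal.{u}}
    (hW : PrefixIndependent W) (h : HasEpsMemoryLE W μ) : HasOrderings W μ := by
  obtain rfl | hne := W.eq_empty_or_nonempty
  · exact hasOrderings_empty h.one_le
  intro B E hE hsat
  obtain ⟨M, A, σ, hM, ⟨hproj, hmem⟩, hwin⟩ := h _ (choiceArena E)
  rw [epsExtension_eq_hat hW hne] at hwin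
  have hinit : SatFrom σ.Edge W σ.init := hwin.2
    ⟨_, returnStrategy E, fun p x _ hp => allSat_returnEdge hsat p x hp⟩
  have hext : ∀ s s' : A, σ.proj s = σ.proj s' → s.1.2 = s'.1.2 → s = s' := by
    intro s s' h₁ h₂
    rw [hproj, hproj] at h₁
    exact Subtype.ext (Prod.ext h₁ h₂)
  have hvertex : ∀ x : List B, Sum.inl x ∉ (choiceArena E).eve := by
    rintro x ⟨_, _, h⟩
    simp at h
  have hempty : Sum.inr ∅ ∉ (choiceArena E).eve := by
    rintro ⟨A, hA, h⟩
    exact hA.ne_empty (Sum.inr_injective h).symm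
  obtain ⟨st, hst, hedge⟩ := hE.exists_lift σ.Edge
    (fun l s => σ.proj s = .inl l ∧ SatFrom σ.Edge W s)
    (fun l => by
      obtain ⟨s, hs, he⟩ := σ.adam σ.init none (.inl l) (by rw [σ.proj_init]; exact hempty)
        (by rw [σ.proj_init]; exact ChoiceEdge.start)
      exact ⟨s, hs, hinit.edge hW he⟩)
    (fun l s o l' ⟨hs, hsW⟩ hl => by
      obtain ⟨s', hs', he⟩ := σ.adam s o (.inl l') (by rw [hs]; exact hvertex l)
        (by rw [hs]; exact ChoiceEdge.edge hl)
      exact ⟨s', ⟨hs', hsW.edge hW he⟩, he⟩)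
  let m : List B → M := fun l => (st l).1.2
  -- Keeping only edges from states that satisfy `W` turns winning from the initial state into a
  -- property of all paths.
  let F : A → Option C → A → Prop := fun s o s' => σ.Edge s o s' ∧ SatFrom σ.Edge W s
  have hF : AllSat F W := allSat_of_satFrom fun _ _ _ h => h
  -- Being lower in a fibre means being unable to reach by `ε`'s; so rank comparison `o l' ≤ o l`
  -- within a fibre will force reachability of `l'` from `l`.
  have hwf : WellFounded fun l l' => m l = m l' ∧ ¬ EpsReach F (st l) (st l') := by
    rw [WellFounded.wellFounded_iff_has_min]
    rintro S ⟨l₀, hl₀⟩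
    -- Adam proposes the part of `S` in one fibre. All its vertices lead to the same state `s`, as
    -- memory is kept along `ε`; Eve's choice `l` there is the required minimal element.
    let D : Set (List B) := {l | l ∈ S ∧ m l = m l₀}
    have hD : ∀ l ∈ D, ∃ s : A, σ.proj s = .inr D ∧ s.1.2 = m l₀ ∧ F (st l) none s := by
      intro l hl
      obtain ⟨s, hs, he⟩ := σ.adam (st l) none (.inr D) (by rw [(hst l).1]; exact hvertex l)
        (by rw [(hst l).1]; exact ChoiceEdge.propose hl)
      exact ⟨s, hs, (hmem _ _ he).symm.trans hl.2, he, (hst l).2⟩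
    obtain ⟨s, hs, hsm, he⟩ := hD l₀ ⟨hl₀, rfl⟩
    obtain ⟨c, s', hs'⟩ := σ.exists_edge s
    have hg := σ.proj_edge _ _ _ hs'
    rw [hs] at hg
    obtain ⟨l, hl, hc, hl'⟩ : ∃ l ∈ D, c = none ∧ σ.proj s' = .inl l := by
      generalize hD' : D = D' at hg
      generalize hp' : σ.proj s' = p' at hg
      cases hg with
      | choose h => exact ⟨_, h, rfl, rfl⟩
      | start => exact ((Set.ext_iff.1 hD' l₀).1 ⟨hl₀, rfl⟩).elim
    subst hc
    obtain rfl : s' = st l := hext _ _ (hl'.trans (hst l).1.symm)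
      ((hmem _ _ hs').symm.trans (hsm.trans hl.2.symm))
    refine ⟨l, hl.1, ?_⟩
    rintro l₁ hl₁ ⟨hm, hn⟩
    obtain ⟨s₁, hs₁, hsm₁, he₁⟩ := hD l₁ ⟨hl₁, hm.trans hl.2⟩
    obtain rfl : s₁ = s := hext _ _ (hs₁.trans hs.symm) (hsm₁.trans hsm.symm)
    have hreach : EpsReach F (st l₁) s₁ := .single he₁
    exact hn (hreach.tail ⟨hs', he₁.2.edge hW he₁.1⟩)
  obtain ⟨o, ho, ho'⟩ := exists_rank hwf
  have hF' : ∀ l c l', E l c l' → F (st l) c (st l') := fun l c l' h =>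
    ⟨hedge _ _ _ h, (hst l).2⟩
  refine ⟨M, Ordinal.{u}, inferInstance, inferInstance, o, m, hM, fun l l' hl => ?_, ?_⟩
  · have hm : m l = m l' := hmem _ _ (hedge _ _ _ hl)
    exact ⟨hm, ho' _ _ fun z hz => ⟨hz.1.trans hm.symm, fun hz' => hz.2 (hz'.tail (hF' _ _ _ hl))⟩⟩
  · refine hF.of_simulation st (fun _ => True) (fun _ _ _ _ => trivial) (fun _ _ _ _ _ => trivial)
      ?_ ?_
    · rintro l l' (h | ⟨-, hm, hle⟩) -
      · exact .single (hF' _ _ _ h)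
      · by_contra hn
        exact (ho l l' ⟨hm, hn⟩).not_ge hle
    · rintro l c l' (h | ⟨h, -⟩)
      · exact .of_edge (hF' _ _ _ h)
      · simp at h

/-! ### Memory from orderings -/

/-- The strategy with one memory state in which Eve may use all edges. -/
def fullStrategy {V C : Type u} (G : Arena V C) :
    Strategy G (Set.univ : Set (V × PUnit.{u + 1})) where
  Edge s c s' := G.Edge s.1.1 c s'.1.1
  exists_edge s := by
    obtain ⟨c, y, h⟩ := G.exists_edge s.1.1
    exact ⟨c, ⟨(y, PUnit.unit), trivial⟩, h⟩
  proj s := s.1.1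
  init := ⟨(G.init, PUnit.unit), trivial⟩
  proj_edge _ _ _ h := h
  proj_init := rfl
  adam _ _ y _ h := ⟨⟨(y, PUnit.unit), trivial⟩, rfl, h⟩

theorem isEpsStrategy_fullStrategy {V C : Type u} (G : Arena V (Option C)) :
    (fullStrategy G).IsEpsStrategy :=
  ⟨fun _ => rfl, fun _ _ _ => rfl⟩

/-- It suffices to find `ε`-strategies in the games that Eve wins. -/
theorem hasEpsMemoryLE_of_eveWins {C : Type u} {W : Set (ℕ → C)} {μ : Cardinal.{u}} (hμ : 1 ≤ μ)
    (h : ∀ (V : Type u) (G : Arena V (Option C)), G.EveWins (epsExtension W) →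
      ∃ (M : Type u) (A : Set (V × M)) (σ : Strategy G A),
        #M ≤ μ ∧ σ.IsEpsStrategy ∧ σ.IsWinning (epsExtension W)) :
    HasEpsMemoryLE W μ := by
  intro V G
  by_cases hG : G.EveWins (epsExtension W)
  · obtain ⟨M, A, σ, hM, hσ, hwin⟩ := h V G hG
    exact ⟨M, A, σ, hM, hσ, fun _ => hG, fun _ => hwin⟩
  · exact ⟨PUnit, _, fullStrategy G, by simpa using hμ, isEpsStrategy_fullStrategy G,
      fun hwin => ⟨_, _, hwin⟩, fun hwin => (hG hwin).elim⟩

theorem ColouredGraph.exists_path {V : Type u} {C : Type v} (G : ColouredGraph V C) (x : V) :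
    ∃ (p : ℕ → V) (c : ℕ → C), p 0 = x ∧ ∀ i, G.Edge (p i) (c i) (p (i + 1)) := by
  choose c y h using G.exists_edge
  refine ⟨fun n => y^[n] x, fun n => c (y^[n] x), rfl, fun i => ?_⟩
  simp only [Function.iterate_succ_apply']
  exact h _

theorem Arena.EveWins.nonempty {V C : Type u} {G : Arena V C} {W : Set (ℕ → C)}
    (h : G.EveWins W) : W.Nonempty := by
  obtain ⟨S, σ, hσ⟩ := h
  obtain ⟨p, c, h0, hp⟩ := σ.exists_path σ.init
  exact ⟨c, hσ p c h0 hp⟩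

/-- The last vertex of a path from `s₀`, which is given as the list of its steps, the last one
being the head of the list. -/
def lastVertex {S : Type u} {D : Type v} (s₀ : S) : List (D × S) → S
  | [] => s₀
  | b :: _ => b.2

/-- The unfolding of a graph into the forest of its paths. -/
def Unfolding {S : Type u} {C : Type v} (E : S → Option C → S → Prop) (s₀ : S)
    (l : List (Option C × S)) (o : Option C) (l' : List (Option C × S)) : Prop :=
  ∃ s, l' = (o, s) :: l ∧ E (lastVertex s₀ l) o s

theorem isForest_unfolding {S : Type u} {C : Type u} (E : S → Option C → S → Prop) (s₀ : S) :
    IsForest (Unfolding E s₀) := by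
  refine ⟨fun l o l' ⟨s, h, _⟩ => ⟨_, h⟩, ?_⟩
  rintro l o o' l' ⟨s, rfl, _⟩ ⟨s', h, _⟩
  simp only [List.cons.injEq, Prod.mk.injEq, and_true] at h
  exact h.1

theorem AllSat.unfolding {S : Type u} {C : Type v} {E : S → Option C → S → Prop}
    {W : Set (ℕ → C)} (h : AllSat E W) (s₀ : S) : AllSat (Unfolding E s₀) W := by
  refine fun p x hp => h (fun i => lastVertex s₀ (p i)) x fun i => ?_
  obtain ⟨s, hs, he⟩ := hp i
  simp only [hs]
  exact he

theorem HasOrderings.hasEpsMemoryLE {C : Type u} {W : Set (ℕ → C)} {μ : Cardinal.{u}}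
    (hμ : 1 ≤ μ) (hW : PrefixIndependent W) (h : HasOrderings W μ) : HasEpsMemoryLE W μ := by
  refine hasEpsMemoryLE_of_eveWins hμ fun V G hG => ?_
  have hne := nonempty_of_epsExtension_nonempty hG.nonempty
  rw [epsExtension_eq_hat hW hne] at hG ⊢
  obtain ⟨S, σ, hσ⟩ := hG
  let F : S → Option C → S → Prop := fun s o s' => σ.Edge s o s' ∧ SatFrom σ.Edge W s
  have hF : AllSat F W := allSat_of_satFrom fun _ _ _ h => h
  let T := Unfolding F σ.init
  obtain ⟨M, α, _, _, o, m, hM, ho⟩ := h _ T (isForest_unfolding F σ.init) (hF.unfolding σ.init)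
  let L : List (Option C × S) → S := lastVertex σ.init
  -- The lists range over all sequences, not only actual paths, so satisfaction of `W` at the last
  -- vertex is imposed explicitly.
  let A : Set (V × M) := {a | ∃ l, SatFrom σ.Edge W (L l) ∧ σ.proj (L l) = a.1 ∧ m l = a.2}
  have hmin : ∀ a : A, ∃ l, (SatFrom σ.Edge W (L l) ∧ σ.proj (L l) = a.1.1 ∧ m l = a.1.2) ∧
      ∀ l', SatFrom σ.Edge W (L l') → σ.proj (L l') = a.1.1 → m l' = a.1.2 → o l ≤ o l' := by
    intro a
    obtain ⟨l, hl, hl'⟩ := (InvImage.wf o (wellFounded_lt (α := α))).has_min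
      {l | SatFrom σ.Edge W (L l) ∧ σ.proj (L l) = a.1.1 ∧ m l = a.1.2} a.2
    exact ⟨l, hl, fun l' h₁ h₂ h₃ => not_lt.1 (hl' l' ⟨h₁, h₂, h₃⟩)⟩
  choose τ hτ hτmin using hmin
  let Edge : A → Option C → A → Prop := fun a c a' =>
    ∃ l', T (τ a) c l' ∧ σ.proj (L l') = a'.1.1 ∧ m l' = a'.1.2
  have hT : ∀ a c s, σ.Edge (L (τ a)) c s → T (τ a) c ((c, s) :: τ a) ∧ SatFrom σ.Edge W s :=
    fun a c s hs => ⟨⟨s, rfl, hs, (hτ a).1⟩, (hτ a).1.edge hW hs⟩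
  have hEdge : ∀ a c s, σ.Edge (L (τ a)) c s →
      ∃ a' : A, a'.1.1 = σ.proj s ∧ Edge a c a' := fun a c s hs =>
    ⟨⟨(σ.proj s, m ((c, s) :: τ a)), (c, s) :: τ a, (hT a c s hs).2, rfl, rfl⟩, rfl,
      (c, s) :: τ a, (hT a c s hs).1, rfl, rfl⟩
  -- An edge of the new strategy is a forest edge followed by a drop, inside a fibre, to the
  -- representative of the target: a path of `withOrder T o m`.
  have hstep : ∀ a c a', Edge a c a' →
      ∃ l', T (τ a) c l' ∧ m l' = m (τ a') ∧ o (τ a') ≤ o l' := by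
    rintro a c a' ⟨l', hl', hp, hm⟩
    refine ⟨l', hl', hm.trans (hτ a').2.2.symm, hτmin a' l' ?_ hp hm⟩
    obtain ⟨s, rfl, hs⟩ := hl'
    exact (hτ a).1.edge hW hs.1
  let ρ : Strategy G A :=
    { Edge := Edge
      exists_edge := fun a => by
        obtain ⟨c, s, hs⟩ := σ.exists_edge (L (τ a))
        obtain ⟨a', -, ha'⟩ := hEdge a c s hs
        exact ⟨c, a', ha'⟩
      proj := fun a => a.1.1
      init := ⟨(G.init, m []), [], hσ, σ.proj_init, rfl⟩
      proj_edge := by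
        rintro a c a' ⟨l', ⟨s, rfl, hs⟩, hp, -⟩
        rw [← hp, ← (hτ a).2.1]
        exact σ.proj_edge _ _ _ hs.1
      proj_init := rfl
      adam := by
        intro a c y ha hy
        rw [← (hτ a).2.1] at ha hy
        obtain ⟨s, rfl, hs⟩ := σ.adam _ c y ha hy
        exact hEdge a c s hs }
  refine ⟨M, A, ρ, hM, ⟨fun _ => rfl, ?_⟩, ?_⟩
  · rintro a a' ⟨l', hl', -, hm⟩
    rw [← (hτ a).2.2, ← hm]
    exact (ho.eps _ _ hl').1
  · have hρ : AllSat Edge W := by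
      refine ho.sat.of_simulation τ (fun _ => True) (fun _ _ _ _ => trivial)
        (fun _ _ _ _ _ => trivial) ?_ ?_
      · intro a a' h _
        obtain ⟨l', hl', hm⟩ := hstep _ _ _ h
        have hreach : EpsReach (withOrder T o m) (τ a) l' := .single (Or.inl hl')
        exact hreach.tail (Or.inr ⟨rfl, hm⟩)
      · intro a c a' h
        obtain ⟨l', hl', hm⟩ := hstep _ _ _ h
        exact ⟨_, l', .refl, Or.inl hl', .single (Or.inr ⟨rfl, hm⟩)⟩
    exact fun p x _ hp => hρ p x hp

/-! ### Lexicographic products -/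

theorem HasEpsMemoryLE.lexProduct {C₁ C₂ : Type u} {W₁ : Set (ℕ → C₁)} {W₂ : Set (ℕ → C₂)}
    {μ₁ μ₂ : Cardinal.{u}} (hW₁ : PrefixIndependent W₁) (hW₂ : PrefixIndependent W₂)
    (h₁ : HasEpsMemoryLE W₁ μ₁) (h₂ : HasEpsMemoryLE W₂ μ₂) :
    HasEpsMemoryLE (lexProduct W₁ W₂) (μ₁ * μ₂) :=
  ((h₁.hasOrderings hW₁).lexProduct hW₁ (h₂.hasOrderings hW₂)).hasEpsMemoryLE
    (one_le_mul h₁.one_le h₂.one_le) (hW₁.lexProduct hW₂)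

theorem prefixIndependent_triviallyLosing : PrefixIndependent triviallyLosing.{u} :=
  fun _ _ => Iff.rfl

theorem prefixIndependent_triviallyWinning : PrefixIndependent triviallyWinning.{u} :=
  fun _ _ => ⟨fun _ => rfl, fun _ => rfl⟩

theorem hasEpsMemoryLE_triviallyLosing : HasEpsMemoryLE triviallyLosing.{u} 1 := by
  refine hasEpsMemoryLE_of_eveWins le_rfl fun V G hG => ?_
  exact (Set.not_nonempty_empty (nonempty_of_epsExtension_nonempty hG.nonempty)).elim

theorem hasEpsMemoryLE_triviallyWinning : HasEpsMemoryLE triviallyWinning.{u} 1 := by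
  refine hasEpsMemoryLE_of_eveWins le_rfl fun V G _ => ?_
  refine ⟨PUnit, _, fullStrategy G, by simp, isEpsStrategy_fullStrategy G, fun p x _ _ => ?_⟩
  rw [epsExtension_eq_hat prefixIndependent_triviallyWinning ⟨_, rfl⟩]
  exact fun _ _ => rfl

theorem mainTheorem4 :
    (∀ (C₁ C₂ : Type u) (W₁ : Set (ℕ → C₁)) (W₂ : Set (ℕ → C₂)) (n₁ n₂ : ℕ),
      PrefixIndependent W₁ → PrefixIndependent W₂ →
      HasEpsMemoryLE W₁ (n₁ : Cardinal.{u}) → HasEpsMemoryLE W₂ (n₂ : Cardinal.{u}) →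
      HasEpsMemoryLE (lexProduct W₁ W₂) ((n₁ * n₂ : ℕ) : Cardinal.{u})) ∧
    (∀ (C : Type u) (W : Set (ℕ → C)) (m : ℕ),
      PrefixIndependent W → HasEpsMemoryLE W (m : Cardinal.{u}) →
      HasEpsMemoryLE (lexProduct W triviallyLosing.{u}) (m : Cardinal.{u}) ∧
      HasEpsMemoryLE (lexProduct W triviallyWinning.{u}) (m : Cardinal.{u}) ∧
      HasEpsMemoryLE (lexProduct triviallyLosing.{u} W) (m : Cardinal.{u}) ∧
      HasEpsMemoryLE (lexProduct triviallyWinning.{u} W) (m : Cardinal.{u})) := by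
  refine ⟨fun C₁ C₂ W₁ W₂ n₁ n₂ hW₁ hW₂ h₁ h₂ => ?_, fun C W m hW h => ⟨?_, ?_, ?_, ?_⟩⟩
  · rw [Nat.cast_mul]
    exact h₁.lexProduct hW₁ hW₂ h₂
  · simpa using h.lexProduct hW prefixIndependent_triviallyLosing hasEpsMemoryLE_triviallyLosing
  · simpa using h.lexProduct hW prefixIndependent_triviallyWinning hasEpsMemoryLE_triviallyWinning
  · simpa using hasEpsMemoryLE_triviallyLosing.lexProduct prefixIndependent_triviallyLosing hW h
  · simpa using hasEpsMemoryLE_triviallyWinning.lexProduct prefixIndependent_triviallyWinning hW h
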